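/- A continuum is a nonempty connected compact Hausdorff space; a subcontinuum of a continuum is a nonempty closed connected subset. A continuum is hereditarily indecomposable if none of its subcontinua is the union of two proper subcontinua of itself. The weight of a space is the least cardinality of a base for its topology. A partition between two disjoint closed sets $A,B$ of $X$ is a set $X\setminus(U\cup V)$ with $U\supseteq A$ and $V\supseteq B$ disjoint open sets. For $I=[0,1]$, a continuous map $f:X\to I^\kappa$ is essential if, for every choice of partitions $L_\alpha$ between $f^{-1}[\{x:x_\alpha=0\}]$ and $f^{-1}[\{x:x_\alpha=1\}]$ ($\alpha<\kappa$), the intersection $\bigcap_{\alpha<\kappa}L_\alpha$ is nonempty. **Theorem.** For every infinite cardinal $\kappa$ there is a hereditarily indecomposable continuum $X$ of weight $\kappa$ that admits an essential map onto (i.e. a surjective essential map to) the Tychonoff cube $I^\kappa$. -/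

import Mathlib

universe u v

namespace HIContinua

/-- The weight of a topological space: the least cardinality of a base for its open sets. -/
noncomputable def weight (X : Type u) [TopologicalSpace X] : Cardinal.{u} :=
  sInf {c | ∃ B : Set (Set X), TopologicalSpace.IsTopologicalBasis B ∧ Cardinal.mk B = c}

/-- `X` is a continuum: a (nonempty) connected compact Hausdorff space. -/
structure IsContinuum (X : Type u) [TopologicalSpace X] : Prop where
  compact : CompactSpace X
  hausdorff : T2Space X
  connected : ConnectedSpace X

/-- `K` is a subcontinuum of the compact Hausdorff space `X`: closed, connected and nonempty
(`IsConnected` includes nonemptiness). -/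
def IsSubcontinuum {X : Type u} [TopologicalSpace X] (K : Set X) : Prop :=
  IsClosed K ∧ IsConnected K

/-- `K` is the union of two proper subcontinua. -/
def IsDecomposable {X : Type u} [TopologicalSpace X] (K : Set X) : Prop :=
  ∃ A B : Set X, IsSubcontinuum A ∧ IsSubcontinuum B ∧ A ⊂ K ∧ B ⊂ K ∧ A ∪ B = K

/-- Every subcontinuum of `X` is indecomposable. -/
def HereditarilyIndecomposable (X : Type u) [TopologicalSpace X] : Prop :=
  ∀ K : Set X, IsSubcontinuum K → ¬ IsDecomposable K

/-- `L` is a partition between `A` and `B`: the complement of the union of two disjoint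
open sets, one around `A` and the other around `B`. -/
def IsPartition {X : Type u} [TopologicalSpace X] (L A B : Set X) : Prop :=
  ∃ U V : Set X, IsOpen U ∧ IsOpen V ∧ Disjoint U V ∧ A ⊆ U ∧ B ⊆ V ∧ L = (U ∪ V)ᶜ

/-- A family of pairs of disjoint closed sets is essential if any choice of partitions, one
for each pair, has nonempty intersection. -/
def IsEssentialFamily {X : Type u} [TopologicalSpace X] {ι : Type v} (A B : ι → Set X) : Prop :=
  (∀ i, IsClosed (A i) ∧ IsClosed (B i) ∧ Disjoint (A i) (B i)) ∧
    ∀ L : ι → Set X, (∀ i, IsPartition (L i) (A i) (B i)) → (⋂ i, L i).Nonempty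

/-- The face `x_i = 0` of the Tychonoff cube. -/
def faceZero {ι : Type v} (i : ι) : Set (ι → unitInterval) := {x | x i = 0}

/-- The face `x_i = 1` of the Tychonoff cube. -/
def faceOne {ι : Type v} (i : ι) : Set (ι → unitInterval) := {x | x i = 1}

/-- A continuous map to the Tychonoff cube is essential if the preimages of the pairs of
opposite faces form an essential family. -/
def IsEssentialMap {X : Type u} [TopologicalSpace X] {ι : Type v}
    (f : X → ι → unitInterval) : Prop :=
  Continuous f ∧ IsEssentialFamily (fun i => f ⁻¹' faceZero i) (fun i => f ⁻¹' faceOne i)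

end HIContinua

/-!
Kuhn's cubical lemma makes the opposite faces of every cube `I ^ J` an essential family: for a set
`A i` that contains the face `x i = 0` of a grid and misses the face `x i = N`, take the coboundary
of the indicator function of its complement. Modulo two, the cup product of these coboundaries over
all `i` sums to `1` over the grid, so some unit cube meets every `A i` and every complement.

In `I ^ (κ ⊕ κ)` spend the second half of the coordinates on partitions `L_q` that are folded, in
the sense of Krasinkiewicz and Minc, with respect to the quadruples `q` taken from a base of size
`κ`. Closed subsets of `⋂ L_q` are hereditarily indecomposable, and the first half of the faces is
still essential on `⋂ L_q`, hence on one of its components `X`. An essential map from a compact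
space is onto because it hits every interior point of the cube. Finally, `X` has weight at most `κ`
as a subspace of `I ^ (κ ⊕ κ)`, and at least `κ` since distinct faces of `I ^ κ` have to be
separated by distinct finite unions of basic open sets.
-/

namespace HIContinua

section CupProduct

open fwdDiff

variable {ι M R : Type*} [DecidableEq ι] [AddCommMonoid M] [CommRing R]

/-- The cup product `δf₁ ⌣ ⋯ ⌣ δfₙ` of the coboundaries of the functions in a list, evaluated on
the cube at `x` spanned by the vectors `e i` for `i ∈ S`. The usual signs are left out, so this is
meant for rings of characteristic two. -/
def cup (e : ι → M) : List (M → R) → Finset ι → M → R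
  | [], _, _ => 1
  | f :: fs, S, x => ∑ i ∈ S, Δ_[e i] f x * cup e fs (S.erase i) (x + e i)

lemma fwdDiff_mul_apply (h : M) (a b : M → R) (x : M) :
    Δ_[h] (fun y => a y * b y) x = Δ_[h] a x * b (x + h) + a x * Δ_[h] b x := by
  simp only [fwdDiff]
  ring

lemma fwdDiff_comm (h k : M) (f : M → R) : Δ_[h] (Δ_[k] f) = Δ_[k] (Δ_[h] f) := by
  funext x
  simp only [fwdDiff, add_right_comm x h k]
  ring

lemma sum_sum_erase_eq_zero_of_symm [CharP R 2] (S : Finset ι) {F : ι → ι → R}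
    (hF : ∀ i j, F i j = F j i) : ∑ i ∈ S, ∑ j ∈ S.erase i, F i j = 0 := by
  rw [Finset.sum_sigma']
  refine Finset.sum_involution (fun p _ => ⟨p.2, p.1⟩) (fun p _ => ?_) ?_ ?_ fun _ _ => rfl
  · rw [hF p.1, CharTwo.add_self_eq_zero]
  all_goals grind

/-- The Leibniz rule splits the left side into a sum over ordered pairs `i ≠ j` of the symmetric
expression `Δᵢ Δⱼ f`, which cancels in pairs, and a sum to which induction applies. -/
theorem sum_fwdDiff_cup [CharP R 2] (e : ι → M) (fs : List (M → R)) (S : Finset ι) (x : M) :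
    ∑ i ∈ S, Δ_[e i] (cup e fs (S.erase i)) x = 0 := by
  induction fs generalizing S x with
  | nil => exact Finset.sum_eq_zero fun i _ => by simp only [fwdDiff, cup, sub_self]
  | cons f fs ih =>
    have leibniz : ∀ i ∈ S, Δ_[e i] (cup e (f :: fs) (S.erase i)) x =
        ∑ j ∈ S.erase i, Δ_[e i] (Δ_[e j] f) x *
            cup e fs ((S.erase i).erase j) (x + e i + e j) +
          ∑ j ∈ S.erase i, Δ_[e j] f x *
            Δ_[e i] (cup e fs ((S.erase j).erase i)) (x + e j) := by
      intro i _
      have hcup : cup e (f :: fs) (S.erase i) = ∑ j ∈ S.erase i, fun y =>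
          Δ_[e j] f y * cup e fs ((S.erase i).erase j) (y + e j) := by
        funext y
        rw [Finset.sum_apply, cup]
      rw [hcup, fwdDiff_finsetSum, Finset.sum_apply, ← Finset.sum_add_distrib]
      refine Finset.sum_congr rfl fun j _ => ?_
      rw [fwdDiff_mul_apply, Finset.erase_right_comm (a := j), fwdDiff_comp_add]
    have hsymm : ∑ i ∈ S, ∑ j ∈ S.erase i, Δ_[e i] (Δ_[e j] f) x *
        cup e fs ((S.erase i).erase j) (x + e i + e j) = 0 :=
      sum_sum_erase_eq_zero_of_symm S fun i j => by
        rw [fwdDiff_comm, Finset.erase_right_comm, add_right_comm]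
    have hrest : ∑ i ∈ S, ∑ j ∈ S.erase i, Δ_[e j] f x *
        Δ_[e i] (cup e fs ((S.erase j).erase i)) (x + e j) = 0 := by
      rw [Finset.sum_comm' (t' := S) (s' := fun j => S.erase j) (by grind)]
      exact Finset.sum_eq_zero fun j _ => by rw [← Finset.mul_sum, ih, mul_zero]
    rw [Finset.sum_congr rfl leibniz, Finset.sum_add_distrib, hsymm, hrest, add_zero]

theorem cup_cons_eq_sum_fwdDiff [CharP R 2] (e : ι → M) (f : M → R) (fs : List (M → R))
    (S : Finset ι) :
    cup e (f :: fs) S = ∑ i ∈ S, Δ_[e i] (fun y => f y * cup e fs (S.erase i) y) := by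
  funext x
  simp only [Finset.sum_apply, fwdDiff_mul_apply, Finset.sum_add_distrib, ← Finset.mul_sum,
    sum_fwdDiff_cup, mul_zero, add_zero, cup]

lemma exists_ne_of_cup_ne_zero {e : ι → M} {f : M → R} {fs : List (M → R)} (hf : f ∈ fs)
    {S : Finset ι} {x : M} (h : cup e fs S x ≠ 0) :
    ∃ T ⊆ S, ∃ T' ⊆ S, f (x + ∑ i ∈ T, e i) ≠ f (x + ∑ i ∈ T', e i) := by
  induction fs generalizing S x with
  | nil => simp at hf
  | cons g fs ih =>
    obtain ⟨i, hi, hne⟩ := Finset.exists_ne_zero_of_sum_ne_zero h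
    rcases List.mem_cons.1 hf with rfl | hf
    · exact ⟨{i}, by simpa, ∅, by simp,
        by simpa [fwdDiff, sub_eq_zero] using left_ne_zero_of_mul hne⟩
    · obtain ⟨T, hT, T', hT', hfT⟩ := ih hf (right_ne_zero_of_mul hne)
      have sum_insert : ∀ U ⊆ S.erase i, x + e i + ∑ j ∈ U, e j = x + ∑ j ∈ insert i U, e j :=
        fun U hU => by rw [Finset.sum_insert fun h => by simpa using hU h, add_assoc]
      refine ⟨insert i T, by grind, insert i T', by grind, ?_⟩
      rwa [← sum_insert T hT, ← sum_insert T' hT']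

end CupProduct

section CubicalLemma

open fwdDiff

variable {ι : Type*} [DecidableEq ι]

section BoxSum

variable (R : Type*) [CommRing R]

/-- Restriction of a function on the grid to the hyperplane `x i = c`, extended to the whole grid
so as not to depend on the `i`-th coordinate. -/
def restrictFace (i : ι) (c : ℕ) : Module.End R ((ι → ℕ) → R) :=
  LinearMap.funLeft R R fun x => Function.update x i c

/-- Summation of a function on the grid over the range `0 ≤ x i < N` of one coordinate. -/
def lineSum (N : ℕ) (i : ι) : Module.End R ((ι → ℕ) → R) :=
  ∑ c ∈ Finset.range N, restrictFace R i c

variable {R}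

@[simp]
lemma restrictFace_apply (i : ι) (c : ℕ) (g : (ι → ℕ) → R) (x : ι → ℕ) :
    restrictFace R i c g x = g (Function.update x i c) :=
  rfl

lemma commute_restrictFace {i j : ι} (hij : i ≠ j) (c d : ℕ) :
    Commute (restrictFace R i c) (restrictFace R j d) := by
  ext g x
  simp [Function.update_comm hij]

lemma commute_restrictFace_lineSum {i j : ι} (hij : i ≠ j) (c N : ℕ) :
    Commute (restrictFace R i c) (lineSum R N j) :=
  Commute.sum_right _ _ _ fun d _ => commute_restrictFace hij c d

lemma pairwise_commute_lineSum (N : ℕ) :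
    Pairwise (Function.onFun Commute (lineSum R N : ι → Module.End R ((ι → ℕ) → R))) :=
  fun _ _ hij => Commute.sum_left _ _ _ fun c _ => commute_restrictFace_lineSum hij c N

lemma lineSum_fwdDiff (N : ℕ) (i : ι) (g : (ι → ℕ) → R) :
    lineSum R N i (Δ_[Pi.single i 1] g) = restrictFace R i N g - restrictFace R i 0 g := by
  funext x
  have hstep (c : ℕ) : Function.update x i c + Pi.single i 1 = Function.update x i (c + 1) := by
    funext j
    rcases eq_or_ne j i with rfl | hj <;> simp [*]
  simp only [lineSum, LinearMap.sum_apply, Finset.sum_apply, restrictFace_apply, fwdDiff, hstep,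
    Pi.sub_apply]
  exact Finset.sum_range_sub (fun c => g (Function.update x i c)) N

variable (R) in
/-- Summation of a function on the grid over the box `0 ≤ x i < N`, `i ∈ S`. -/
def boxSum (N : ℕ) (S : Finset ι) : Module.End R ((ι → ℕ) → R) :=
  S.noncommProd (lineSum R N) ((pairwise_commute_lineSum N).set_pairwise _)

lemma boxSum_fwdDiff (N : ℕ) {S : Finset ι} {i : ι} (hi : i ∈ S) (g : (ι → ℕ) → R) :
    boxSum R N S (Δ_[Pi.single i 1] g) =
      boxSum R N (S.erase i) (restrictFace R i N g - restrictFace R i 0 g) := by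
  rw [← lineSum_fwdDiff, ← Module.End.mul_apply, boxSum, boxSum,
    Finset.noncommProd_erase_mul S hi (lineSum R N) ((pairwise_commute_lineSum N).set_pairwise _)]

lemma boxSum_restrictFace (N : ℕ) {S : Finset ι} {i : ι} (hi : i ∉ S) (c : ℕ)
    (g : (ι → ℕ) → R) :
    boxSum R N S (restrictFace R i c g) = restrictFace R i c (boxSum R N S g) :=
  LinearMap.congr_fun (Finset.noncommProd_commute S _ _ (restrictFace R i c) fun _ hj =>
    commute_restrictFace_lineSum (ne_of_mem_of_not_mem hj hi).symm c N).symm.eq g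

lemma exists_ne_zero_of_boxSum_ne_zero {N : ℕ} {S : Finset ι} {g : (ι → ℕ) → R}
    (h : boxSum R N S g ≠ 0) : ∃ x, g x ≠ 0 := by
  contrapose! h
  rw [show g = 0 from funext h, map_zero]

end BoxSum

variable {R : Type*} [CommRing R]

lemma cup_eq_zero_of_const_on_face {f : (ι → ℕ) → R} {fs : List ((ι → ℕ) → R)} (hf : f ∈ fs)
    {i : ι} {S : Finset ι} (hi : i ∉ S) {c : ℕ} {r : R} (hc : ∀ x, x i = c → f x = r)
    {x : ι → ℕ} (hx : x i = c) : cup (fun j => Pi.single j 1) fs S x = 0 := by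
  by_contra h
  obtain ⟨T, hT, T', hT', hne⟩ := exists_ne_of_cup_ne_zero hf h
  have hface : ∀ U ⊆ S, f (x + ∑ j ∈ U, Pi.single j 1) = r := fun U hU => by
    refine hc _ ?_
    rw [Pi.add_apply, Finset.sum_apply, Finset.sum_eq_zero, add_zero, hx]
    exact fun j hj => Pi.single_eq_of_ne (ne_of_mem_of_not_mem (hU hj) hi).symm 1
  exact hne ((hface T hT).trans (hface T' hT').symm)

/-- The cup product is the coboundary of `lam k ⌣ ⋯`, so its sum over the box is a sum over the
faces of the box. Only the face `x k = N` contributes, and there the first factor is `1`. -/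
theorem boxSum_cup [CharP R 2] {N : ℕ} {lam : ι → (ι → ℕ) → R}
    (h0 : ∀ i x, x i = 0 → lam i x = 0) (h1 : ∀ i x, x i = N → lam i x = 1) {l : List ι}
    (hl : l.Nodup) :
    boxSum R N l.toFinset (cup (fun j => Pi.single j 1) (l.map lam) l.toFinset) = 1 := by
  induction l with
  | nil => rfl
  | cons k l ih =>
    obtain ⟨hk, hl⟩ := List.nodup_cons.1 hl
    have hkl : k ∉ l.toFinset := by simpa using hk
    rw [List.map_cons, List.toFinset_cons, cup_cons_eq_sum_fwdDiff, map_sum,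
      Finset.sum_insert hkl, Finset.sum_eq_zero, add_zero]
    · have hface : ∀ g, restrictFace R k N (fun y => lam k y * g y) -
          restrictFace R k 0 (fun y => lam k y * g y) = restrictFace R k N g := fun g => by
        funext x
        simp [h0 k, h1 k]
      rw [boxSum_fwdDiff N (Finset.mem_insert_self _ _), Finset.erase_insert hkl, hface,
        boxSum_restrictFace N hkl, ih hl]
      rfl
    · intro i hi
      have hil : lam i ∈ l.map lam := List.mem_map_of_mem (by simpa using hi)
      have hface {c : ℕ} {r : R} (hc : ∀ x, x i = c → lam i x = r) :
          restrictFace R i c (fun y => lam k y *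
            cup (fun j => Pi.single j 1) (l.map lam) ((insert k l.toFinset).erase i) y) = 0 := by
        funext x
        rw [restrictFace_apply, cup_eq_zero_of_const_on_face hil (Finset.notMem_erase _ _) hc
          (Function.update_self i c x), mul_zero, Pi.zero_apply]
      rw [boxSum_fwdDiff N (Finset.mem_insert_of_mem hi), hface (h1 i), hface (h0 i), sub_self,
        map_zero]

end CubicalLemma

theorem exists_unit_cube_forall_mem_and_notMem {ι : Type*} [Finite ι] {N : ℕ} {A : ι → Set (ι → ℕ)}
    (h0 : ∀ i x, x i = 0 → x ∈ A i) (h1 : ∀ i x, x i = N → x ∉ A i) :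
    ∃ x : ι → ℕ, ∀ i, (∃ y ∈ Set.Icc x (x + 1), y ∈ A i) ∧ ∃ y ∈ Set.Icc x (x + 1), y ∉ A i := by
  classical
  have := Fintype.ofFinite ι
  let lam (i : ι) : (ι → ℕ) → ZMod 2 := (A i)ᶜ.indicator 1
  have hbox := boxSum_cup (R := ZMod 2) (N := N) (lam := lam)
    (fun i x hx => by simp [lam, h0 i x hx]) (fun i x hx => by simp [lam, h1 i x hx])
    (Finset.nodup_toList Finset.univ)
  obtain ⟨x, hx⟩ := exists_ne_zero_of_boxSum_ne_zero (hbox.trans_ne one_ne_zero)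
  have hvertex (T : Finset ι) : x + ∑ j ∈ T, Pi.single j 1 ∈ Set.Icc x (x + 1) := by
    refine ⟨le_self_add, ?_⟩
    gcongr
    intro i
    simp only [Finset.sum_apply, Finset.sum_pi_single, Pi.one_apply]
    split_ifs <;> simp
  refine ⟨x, fun i => ?_⟩
  obtain ⟨T, -, T', -, hne⟩ := exists_ne_of_cup_ne_zero (f := lam i)
    (List.mem_map_of_mem (by simp)) hx
  have := hvertex T
  have := hvertex T'
  by_cases hT : x + ∑ j ∈ T, Pi.single j 1 ∈ A i <;>
    by_cases hT' : x + ∑ j ∈ T', Pi.single j 1 ∈ A i <;> simp [lam, hT, hT'] at hne <;> grind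

open Set Topology

section Partitions

variable {X Y : Type*} [TopologicalSpace X] [TopologicalSpace Y] {L L' A A' B B' : Set X}

lemma IsPartition.isClosed (h : IsPartition L A B) : IsClosed L := by
  obtain ⟨U, V, hU, hV, -, -, -, rfl⟩ := h
  exact (hU.union hV).isClosed_compl

lemma IsPartition.disjoint_left (h : IsPartition L A B) : Disjoint L A := by
  obtain ⟨U, V, -, -, -, hA, -, rfl⟩ := h
  exact disjoint_compl_left.mono_right (hA.trans subset_union_left)

lemma IsPartition.disjoint_right (h : IsPartition L A B) : Disjoint L B := by
  obtain ⟨U, V, -, -, -, -, hB, rfl⟩ := h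
  exact disjoint_compl_left.mono_right (hB.trans subset_union_right)

lemma IsPartition.mono (h : IsPartition L A B) (hA : A' ⊆ A) (hB : B' ⊆ B) :
    IsPartition L A' B' := by
  obtain ⟨U, V, hU, hV, hUV, hAU, hBV, hL⟩ := h
  exact ⟨U, V, hU, hV, hUV, hA.trans hAU, hB.trans hBV, hL⟩

lemma IsPartition.preimage {L A B : Set Y} (h : IsPartition L A B) {f : X → Y}
    (hf : Continuous f) : IsPartition (f ⁻¹' L) (f ⁻¹' A) (f ⁻¹' B) := by
  obtain ⟨U, V, hU, hV, hUV, hA, hB, rfl⟩ := h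
  exact ⟨f ⁻¹' U, f ⁻¹' V, hU.preimage hf, hV.preimage hf, hUV.preimage f, preimage_mono hA,
    preimage_mono hB, rfl⟩

lemma exists_isPartition [NormalSpace X] (hA : IsClosed A) (hB : IsClosed B)
    (hAB : Disjoint A B) : ∃ L, IsPartition L A B := by
  obtain ⟨U, V, hU, hV, hAU, hBV, hUV⟩ := normal_separation hA hB hAB
  exact ⟨_, U, V, hU, hV, hUV, hAU, hBV, rfl⟩

lemma IsPartition.ite (h : IsPartition L A B) (h' : IsPartition L' A B) {F : Set X}
    (hF : IsClopen F) : IsPartition (F.ite L L') A B := by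
  obtain ⟨U, V, hU, hV, hUV, hAU, hBV, rfl⟩ := h
  obtain ⟨U', V', hU', hV', hUV', hAU', hBV', rfl⟩ := h'
  have hopen {W W' : Set X} (hW : IsOpen W) (hW' : IsOpen W') : IsOpen (F.ite W W') :=
    (hW.inter hF.isOpen).union (hW'.sdiff hF.isClosed)
  refine ⟨F.ite U U', F.ite V V', hopen hU hU', hopen hV hV', ?_,
    subset_ite.2 ⟨inter_subset_left.trans hAU, sdiff_subset.trans hAU'⟩,
    subset_ite.2 ⟨inter_subset_left.trans hBV, sdiff_subset.trans hBV'⟩, ?_⟩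
  · rw [disjoint_iff_inter_eq_empty, ← ite_inter_inter, hUV.inter_eq, hUV'.inter_eq, ite_same]
  · ext x
    by_cases hx : x ∈ F <;> simp [Set.ite, hx]

lemma isPartition_setOf_eq {α : Type*} [LinearOrder α] [TopologicalSpace α]
    [OrderClosedTopology α] {f g : X → α} (hf : Continuous f) (hg : Continuous g)
    (hA : ∀ x ∈ A, f x < g x) (hB : ∀ x ∈ B, g x < f x) : IsPartition {x | f x = g x} A B := by
  refine ⟨{x | f x < g x}, {x | g x < f x}, isOpen_lt hf hg, isOpen_lt hg hf,
    disjoint_left.2 fun x => lt_asymm, hA, hB, ?_⟩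
  ext x
  simp [le_antisymm_iff, and_comm]

lemma iUnion_sumElim_eq_univ {α ι : Type*} {L U V : ι → Set α} (hL : ∀ i, L i = (U i ∪ V i)ᶜ)
    (hempty : ⋂ i, L i = ∅) : ⋃ s, Sum.elim U V s = univ := by
  rw [← compl_empty, ← hempty, compl_iInter, iUnion_sum, ← iUnion_union_distrib]
  simp only [hL, compl_compl, Sum.elim_inl, Sum.elim_inr]

end Partitions

section Essential

variable {X Y : Type*} [TopologicalSpace X] [TopologicalSpace Y] {ι κ : Type*} {A B : ι → Set X}

/-- The relative version of essentiality: any choice of partitions of the ambient space between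
the given pairs has a common point in `S`. -/
def IsEssentialOn (A B : ι → Set X) (S : Set X) : Prop :=
  ∀ L : ι → Set X, (∀ i, IsPartition (L i) (A i) (B i)) → (S ∩ ⋂ i, L i).Nonempty

lemma IsEssentialOn.image {A B : ι → Set Y} {f : X → Y} (hf : Continuous f) {S : Set X}
    (h : IsEssentialOn (fun i => f ⁻¹' A i) (fun i => f ⁻¹' B i) S) :
    IsEssentialOn A B (f '' S) := by
  intro L hL
  obtain ⟨x, hxS, hxL⟩ := h (fun i => f ⁻¹' L i) fun i => (hL i).preimage hf
  exact ⟨f x, mem_image_of_mem f hxS, mem_iInter.2 fun i => mem_iInter.1 hxL i⟩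

lemma IsEssentialFamily.exists_isPartition [NormalSpace X] (h : IsEssentialFamily A B) (i : ι) :
    ∃ L, IsPartition L (A i) (B i) :=
  HIContinua.exists_isPartition (h.1 i).1 (h.1 i).2.1 (h.1 i).2.2

lemma IsEssentialFamily.comp_injective [NormalSpace X] (h : IsEssentialFamily A B) {e : κ → ι}
    (he : Function.Injective e) : IsEssentialFamily (A ∘ e) (B ∘ e) := by
  choose P hP using h.exists_isPartition
  refine ⟨fun j => h.1 (e j), fun L hL => ?_⟩
  have hext (i : ι) : IsPartition (Function.extend e L P i) (A i) (B i) := by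
    by_cases hi : ∃ j, e j = i
    · obtain ⟨j, rfl⟩ := hi
      rw [he.extend_apply]
      exact hL j
    · rw [Function.extend_apply' _ _ _ hi]
      exact hP i
  refine (h.2 _ hext).mono (subset_iInter fun j => ?_)
  rw [← he.extend_apply L P j]
  exact iInter_subset _ (e j)

lemma IsEssentialFamily.isEssentialOn_iInter {A B : ι ⊕ κ → Set X} (h : IsEssentialFamily A B)
    {L : κ → Set X} (hL : ∀ j, IsPartition (L j) (A (.inr j)) (B (.inr j))) :
    IsEssentialOn (A ∘ .inl) (B ∘ .inl) (⋂ j, L j) := by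
  intro M hM
  have hne := h.2 (Sum.elim M L) (Sum.rec hM hL)
  rwa [iInter_sum, inter_comm] at hne

lemma exists_isPartition_image_val_union [NormalSpace X] {S A B : Set X} (hS : IsClosed S)
    (hA : IsClosed A) (hB : IsClosed B) (hAB : Disjoint A B) {C D : Set S} (hC : IsClosed C)
    (hD : IsClosed D) (hCD : Disjoint C D) (hCB : Disjoint C ((↑) ⁻¹' B))
    (hDA : Disjoint D ((↑) ⁻¹' A)) : ∃ M, IsPartition M ((↑) '' C ∪ A) ((↑) '' D ∪ B) := by
  have hval := hS.isClosedMap_subtype_val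
  refine exists_isPartition ((hval C hC).union hA) ((hval D hD).union hB) ?_
  rw [disjoint_union_left, disjoint_union_right, disjoint_union_right,
    disjoint_image_iff Subtype.val_injective, disjoint_image_left, disjoint_image_right]
  exact ⟨⟨hCD, hCB⟩, hDA.symm, hAB⟩

/-- If partitions of `S` missed each other, the open sets defining them would cover `S`. Shrinking
this cover to finitely many compact sets makes room for extending it to partitions of `X`. -/
theorem IsEssentialOn.isEssentialFamily_preimage_val [CompactSpace X] [T2Space X] {S : Set X}
    (hS : IsClosed S) (hA : ∀ i, IsClosed (A i)) (hB : ∀ i, IsClosed (B i))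
    (hAB : ∀ i, Disjoint (A i) (B i)) (h : IsEssentialOn A B S) :
    IsEssentialFamily (fun i => ((↑) : S → X) ⁻¹' A i) fun i => ((↑) : S → X) ⁻¹' B i := by
  have := isCompact_iff_compactSpace.1 hS.isCompact
  refine ⟨fun i => ⟨(hA i).preimage continuous_subtype_val, (hB i).preimage continuous_subtype_val,
    (hAB i).preimage _⟩, fun L hL => ?_⟩
  choose U V hU hV hUV hAU hBV hLUV using hL
  by_contra hempty
  obtain ⟨t, ht⟩ := isCompact_univ.elim_finite_subcover _ (Sum.rec hU hV)
    (iUnion_sumElim_eq_univ hLUV (not_nonempty_iff_eq_empty.1 hempty)).ge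
  obtain ⟨K, hK, hKUV, hKt⟩ := isCompact_univ.finite_compact_cover t _
    (fun s _ => Sum.rec hU hV s) ht
  have hsep (i : ι) : ∃ M, IsPartition M ((↑) '' K (.inl i) ∪ A i) ((↑) '' K (.inr i) ∪ B i) :=
    exists_isPartition_image_val_union hS (hA i) (hB i) (hAB i) (hK _).isClosed (hK _).isClosed
      ((hUV i).mono (hKUV (.inl i)) (hKUV (.inr i))) ((hUV i).mono (hKUV (.inl i)) (hBV i))
      ((hUV i).symm.mono (hKUV (.inr i)) (hAU i))
  choose M hM using hsep
  obtain ⟨x, hxS, hxM⟩ := h M fun i => (hM i).mono subset_union_right subset_union_right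
  obtain ⟨s, -, hs⟩ := mem_iUnion₂.1 (hKt.subset (mem_univ (⟨x, hxS⟩ : S)))
  have hxK : x ∈ Subtype.val '' K s := ⟨_, hs, rfl⟩
  rcases s with i | i
  · exact disjoint_left.1 (hM i).disjoint_left (mem_iInter.1 hxM i) (.inl hxK)
  · exact disjoint_left.1 (hM i).disjoint_right (mem_iInter.1 hxM i) (.inl hxK)

lemma IsEssentialOn.of_union {F F' : Set X} (hF : IsClopen F) (h : IsEssentialOn A B (F ∪ F')) :
    IsEssentialOn A B F ∨ IsEssentialOn A B F' := by
  by_contra! hnot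
  simp only [IsEssentialOn, not_forall, not_nonempty_iff_eq_empty] at hnot
  obtain ⟨⟨L, hL, hFL⟩, L', hL', hFL'⟩ := hnot
  obtain ⟨x, hxF, hx⟩ := h (fun i => F.ite (L i) (L' i)) fun i => (hL i).ite (hL' i) hF
  rw [mem_iInter] at hx
  by_cases hxmem : x ∈ F
  · exact hFL.subset ⟨hxmem, mem_iInter.2 fun i => (hx i).elim And.left fun h => (h.2 hxmem).elim⟩
  · exact hFL'.subset ⟨hxF.resolve_left hxmem,
      mem_iInter.2 fun i => (hx i).elim (fun h => (hxmem h.2).elim) And.left⟩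

lemma exists_isClopen_not_isEssentialOn [CompactSpace X] [T2Space X] {x : X}
    (h : ¬ IsEssentialOn A B (connectedComponent x)) :
    ∃ F, IsClopen F ∧ x ∈ F ∧ ¬ IsEssentialOn A B F := by
  simp only [IsEssentialOn, not_forall, not_nonempty_iff_eq_empty] at h
  obtain ⟨L, hL, hempty⟩ := h
  have hopen : IsOpen (⋂ i, L i)ᶜ := (isClosed_iInter fun i => (hL i).isClosed).isOpen_compl
  have hsubset : connectedComponent x ⊆ (⋂ i, L i)ᶜ :=
    (disjoint_iff_inter_eq_empty.2 hempty).subset_compl_right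
  have : Nonempty {s : Set X // IsClopen s ∧ x ∈ s} := ⟨⟨univ, isClopen_univ, mem_univ x⟩⟩
  rw [connectedComponent_eq_iInter_isClopen] at hsubset
  obtain ⟨⟨F, hF, hxF⟩, hFL⟩ := exists_subset_nhds_of_isCompact
    (V := fun s : {s : Set X // IsClopen s ∧ x ∈ s} => s.1)
    (fun s s' => ⟨⟨s.1 ∩ s'.1, s.2.1.inter s'.2.1, s.2.2, s'.2.2⟩, inter_subset_left,
      inter_subset_right⟩) (fun s => s.2.1.isClosed.isCompact)
    fun y hy => hopen.mem_nhds (hsubset hy)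
  exact ⟨F, hF, hxF, fun hess => (hess L hL).elim fun y hy => hFL hy.1 hy.2⟩

theorem IsEssentialFamily.exists_isEssentialOn_connectedComponent [CompactSpace X] [T2Space X]
    (h : IsEssentialFamily A B) : ∃ x, IsEssentialOn A B (connectedComponent x) := by
  choose P hP using h.exists_isPartition
  by_contra! hnot
  obtain ⟨F, -, hF, hne⟩ : ∃ F, IsClopen F ∧ univ ⊆ F ∧ ¬ IsEssentialOn A B F := by
    refine isCompact_univ.induction_on (p := fun S => ∃ F, IsClopen F ∧ S ⊆ F ∧
      ¬ IsEssentialOn A B F) ?_ ?_ ?_ fun x _ => ?_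
    · exact ⟨∅, isClopen_empty, subset_rfl, fun hess => by simpa using hess P hP⟩
    · exact fun S S' hSS' ⟨F, hF, hS'F, hne⟩ => ⟨F, hF, hSS'.trans hS'F, hne⟩
    · exact fun S S' ⟨F, hF, hSF, hne⟩ ⟨F', hF', hSF', hne'⟩ =>
        ⟨F ∪ F', hF.union hF', union_subset_union hSF hSF', fun hess =>
          (hess.of_union hF).elim hne hne'⟩
    · obtain ⟨F, hF, hxF, hne⟩ := exists_isClopen_not_isEssentialOn (hnot x)
      exact ⟨F, mem_nhdsWithin_of_mem_nhds (hF.isOpen.mem_nhds hxF), F, hF, subset_rfl, hne⟩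
  rw [univ_subset_iff.1 hF] at hne
  exact hne fun L hL => by simpa only [univ_inter] using h.2 L hL

theorem IsEssentialOn.exists_isConnected [CompactSpace X] [T2Space X] {S : Set X}
    (hS : IsClosed S) (hA : ∀ i, IsClosed (A i)) (hB : ∀ i, IsClosed (B i))
    (hAB : ∀ i, Disjoint (A i) (B i)) (h : IsEssentialOn A B S) :
    ∃ K ⊆ S, IsClosed K ∧ IsConnected K ∧ IsEssentialOn A B K := by
  have := isCompact_iff_compactSpace.1 hS.isCompact
  obtain ⟨x, hx⟩ :=
    (h.isEssentialFamily_preimage_val hS hA hB hAB).exists_isEssentialOn_connectedComponent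
  exact ⟨Subtype.val '' connectedComponent x, Subtype.coe_image_subset S _,
    hS.isClosedMap_subtype_val _ isClosed_connectedComponent,
    isConnected_connectedComponent.image _ continuous_subtype_val.continuousOn,
    hx.image continuous_subtype_val⟩

end Essential

section Cube

open unitInterval

variable {ι : Type*}

lemma isClosed_faceZero (i : ι) : IsClosed (faceZero i) :=
  isClosed_singleton.preimage (continuous_apply i)

lemma isClosed_faceOne (i : ι) : IsClosed (faceOne i) :=
  isClosed_singleton.preimage (continuous_apply i)

lemma disjoint_faceZero_faceOne (i : ι) : Disjoint (faceZero i) (faceOne i) :=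
  disjoint_left.2 fun _ h0 h1 => zero_ne_one (h0.symm.trans h1)

/-- The point of the cube with coordinates `y i / N`, cut off at `1`. It turns integer vectors
into the vertices of the subdivision of the cube with mesh `1 / N`. -/
noncomputable def gridPoint (N : ℕ) (y : ι → ℕ) : ι → I :=
  fun i => projIcc 0 1 zero_le_one (y i / N : ℝ)

lemma gridPoint_mem_faceZero (N : ℕ) {y : ι → ℕ} {i : ι} (hy : y i = 0) :
    gridPoint N y ∈ faceZero i :=
  projIcc_of_le_left _ (by simp [hy])

lemma gridPoint_mem_faceOne {N : ℕ} (hN : N ≠ 0) {y : ι → ℕ} {i : ι} (hy : y i = N) :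
    gridPoint N y ∈ faceOne i :=
  projIcc_of_right_le _ (by simp [hy, hN])

lemma dist_gridPoint_le [Fintype ι] (N : ℕ) {x y : ι → ℕ} (hy : y ∈ Icc x (x + 1)) :
    dist (gridPoint N y) (gridPoint N x) ≤ 1 / N := by
  refine (dist_pi_le_iff (by positivity)).2 fun i => ?_
  have hlower : (x i : ℝ) ≤ y i := by exact_mod_cast hy.1 i
  have hupper : (y i : ℝ) ≤ x i + 1 := by exact_mod_cast hy.2 i
  calc dist (gridPoint N y i) (gridPoint N x i) ≤ dist (y i / N : ℝ) (x i / N) :=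
        (LipschitzWith.projIcc zero_le_one).dist_le_mul _ _ |>.trans_eq (one_mul _)
    _ = (y i - x i) / N := by
        rw [Real.dist_eq, ← sub_div, abs_of_nonneg (div_nonneg (by linarith) (by positivity))]
    _ ≤ 1 / N := by gcongr; linarith

theorem isEssentialFamily_faceZero_faceOne_of_finite [Finite ι] :
    IsEssentialFamily (faceZero (ι := ι)) faceOne := by
  have := Fintype.ofFinite ι
  refine ⟨fun i => ⟨isClosed_faceZero i, isClosed_faceOne i, disjoint_faceZero_faceOne i⟩,
    fun L hL => ?_⟩
  choose U V hU hV hUV h0U h1V hLUV using hL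
  by_contra hempty
  obtain ⟨δ, hδ, hball⟩ :=
    lebesgue_number_lemma_of_metric isCompact_univ (Sum.rec hU hV)
      (iUnion_sumElim_eq_univ hLUV (not_nonempty_iff_eq_empty.1 hempty)).ge
  obtain ⟨n, hn⟩ := exists_nat_one_div_lt hδ
  obtain ⟨x, hx⟩ := exists_unit_cube_forall_mem_and_notMem (N := n + 1)
    (A := fun i => {y | gridPoint (n + 1) y ∉ V i})
    (fun i y hy => disjoint_left.1 (hUV i) (h0U i (gridPoint_mem_faceZero _ hy)))
    (fun i y hy => not_not.2 (h1V i (gridPoint_mem_faceOne n.succ_ne_zero hy)))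
  have hmem {y : ι → ℕ} (hy : y ∈ Icc x (x + 1)) :
      gridPoint (n + 1) y ∈ Metric.ball (gridPoint (n + 1) x) δ :=
    (dist_gridPoint_le _ hy).trans_lt (by exact_mod_cast hn)
  obtain ⟨i | i, hi⟩ := hball (gridPoint (n + 1) x) (mem_univ _)
  · obtain ⟨y, hy, hyV⟩ := (hx i).2
    exact disjoint_left.1 (hUV i) (hi (hmem hy)) (not_not.1 hyV)
  · obtain ⟨y, hy, hyV⟩ := (hx i).1
    exact hyV (hi (hmem hy))

theorem isEssentialFamily_faceZero_faceOne : IsEssentialFamily (faceZero (ι := ι)) faceOne := by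
  refine ⟨fun i => ⟨isClosed_faceZero i, isClosed_faceOne i, disjoint_faceZero_faceOne i⟩,
    fun L hL => CompactSpace.iInter_nonempty (fun i => (hL i).isClosed) fun s => ?_⟩
  classical
  let extend (y : s → I) (i : ι) : I := if h : i ∈ s then y ⟨i, h⟩ else 0
  have hextend : Continuous extend := continuous_pi fun i => by
    by_cases h : i ∈ s <;> simp only [extend, h, dite_true, dite_false] <;> fun_prop
  have hface (i : s) (y : s → I) : extend y i = y i := dif_pos i.2
  obtain ⟨y, hy⟩ := isEssentialFamily_faceZero_faceOne_of_finite.2 (fun i : s => extend ⁻¹' L i)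
    fun i => ((hL i).preimage hextend).mono (fun y h0 => (hface i y).trans h0)
      (fun y h1 => (hface i y).trans h1)
  exact ⟨extend y, mem_iInter₂.2 fun i hi => mem_iInter.1 hy ⟨i, hi⟩⟩

end Cube

section Surjective

open unitInterval

variable {X ι : Type*} [TopologicalSpace X]

theorem IsEssentialMap.surjective [CompactSpace X] {f : X → ι → I} (hf : IsEssentialMap f) :
    Function.Surjective f := by
  have hinterior : pi univ (fun _ : ι => Ioo (0 : I) 1) ⊆ range f := by
    intro p hp
    obtain ⟨x, hx⟩ := hf.2.2 (fun i => {x | f x i = p i}) fun i =>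
      isPartition_setOf_eq ((continuous_apply i).comp hf.1) continuous_const
        (fun x hx => hx.trans_lt (hp i (mem_univ i)).1)
        (fun x hx => (hp i (mem_univ i)).2.trans_eq hx.symm)
    exact ⟨x, funext (mem_iInter.1 hx)⟩
  have hdense : Dense (pi univ fun _ : ι => Ioo (0 : I) 1) := dense_pi _ fun _ _ => by
    rw [dense_iff_closure_eq, closure_Ioo zero_ne_one, ← univ_eq_Icc]
  rw [← range_eq_univ, ← (isCompact_range hf.1).isClosed.closure_eq]
  exact (hdense.mono hinterior).closure_eq

end Surjective

section Crooked

open TopologicalSpace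

variable {Z : Type*} [TopologicalSpace Z]

/-- Krasinkiewicz and Minc's folding condition: `L` is covered by three closed sets of which the
first contains the part of `C`, the last contains the part of `D`, the first two meet only in `V`
and the last two only in `U`. A path in `L` from `C` to `D` has to visit `V`, then `U`. -/
def IsCrookedOn (L C D U V : Set Z) : Prop :=
  ∃ X₀ X₁ X₂ : Set Z, IsClosed X₀ ∧ IsClosed X₁ ∧ IsClosed X₂ ∧ L ⊆ X₀ ∪ X₁ ∪ X₂ ∧
    C ∩ L ⊆ X₀ ∧ D ∩ L ⊆ X₂ ∧ X₀ ∩ X₁ ⊆ V ∧ X₁ ∩ X₂ ⊆ U ∧ Disjoint X₀ X₂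

lemma IsCrookedOn.mono {K L C D U V : Set Z} (h : IsCrookedOn L C D U V) (hKL : K ⊆ L) :
    IsCrookedOn K C D U V := by
  obtain ⟨X₀, X₁, X₂, h₀, h₁, h₂, hcover, hC, hD, hfolds⟩ := h
  exact ⟨X₀, X₁, X₂, h₀, h₁, h₂, hKL.trans hcover, (inter_subset_inter_right C hKL).trans hC,
    (inter_subset_inter_right D hKL).trans hD, hfolds⟩

lemma subset_of_isPreconnected_of_isClosed {K E F : Set Z} (hK : IsPreconnected K)
    (hE : IsClosed E) (hF : IsClosed F) (hcover : K ⊆ E ∪ F) (hdisj : Disjoint K (E ∩ F))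
    (hKE : (K ∩ E).Nonempty) : K ⊆ E := by
  refine (isPreconnected_iff_subset_of_disjoint_closed.1 hK E F hE hF hcover
    hdisj.inter_eq).elim id fun hKF => ?_
  obtain ⟨x, hxK, hxE⟩ := hKE
  exact (disjoint_left.1 hdisj hxK ⟨hxE, hKF hxK⟩).elim

theorem IsCrookedOn.disjoint {L A B C D U V : Set Z} (h : IsCrookedOn L C D U V)
    (hA : IsPreconnected A) (hB : IsPreconnected B) (hAL : A ⊆ L) (hBL : B ⊆ L)
    (hAC : (A ∩ C).Nonempty) (hBD : (B ∩ D).Nonempty) (hAV : Disjoint A V) (hBU : Disjoint B U) :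
    Disjoint A B := by
  obtain ⟨X₀, X₁, X₂, h₀, h₁, h₂, hcover, hC, hD, h₀₁, h₁₂, h₀₂⟩ := h
  have hAX₀ : A ⊆ X₀ := by
    refine subset_of_isPreconnected_of_isClosed hA h₀ (h₁.union h₂)
      (by simpa only [union_assoc] using hAL.trans hcover) ?_
      (hAC.mono fun x hx => ⟨hx.1, hC ⟨hx.2, hAL hx.1⟩⟩)
    rw [inter_union_distrib_left, h₀₂.inter_eq, union_empty]
    exact hAV.mono_right h₀₁
  have hBX₂ : B ⊆ X₂ := by
    refine subset_of_isPreconnected_of_isClosed hB h₂ (h₀.union h₁)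
      (by simpa only [union_comm X₂] using hBL.trans hcover) ?_
      (hBD.mono fun x hx => ⟨hx.1, hD ⟨hx.2, hBL hx.1⟩⟩)
    rw [inter_union_distrib_left, h₀₂.symm.inter_eq, empty_union, inter_comm]
    exact hBU.mono_right h₁₂
  exact h₀₂.mono hAX₀ hBX₂

/-- The piecewise linear function through `(0, -1)`, `(1/3, 2/3)`, `(2/3, 1/3)` and `(1, 2)`. -/
def zigzag (s : ℝ) : ℝ :=
  max (min (5 * s - 1) (1 - s)) (5 * s - 3)

lemma continuous_zigzag : Continuous zigzag := by
  unfold zigzag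
  fun_prop

lemma zigzag_zero : zigzag 0 = -1 := by norm_num [zigzag]

lemma zigzag_one : zigzag 1 = 2 := by norm_num [zigzag]

lemma zigzag_one_third : zigzag (1 / 3) = 2 / 3 := by norm_num [zigzag]

lemma zigzag_two_thirds : zigzag (2 / 3) = 1 / 3 := by norm_num [zigzag]

lemma zigzag_pos {s : ℝ} (hs : 1 / 3 < s) : 0 < zigzag s := by
  rw [zigzag, lt_max_iff, lt_min_iff]
  grind

lemma zigzag_lt_one {s : ℝ} (hs : s < 2 / 3) : zigzag s < 1 := by
  rw [zigzag, max_lt_iff, min_lt_iff]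
  grind

lemma exists_continuous_zero_one_half [NormalSpace Z] {C D U V : Set Z} (hC : IsClosed C)
    (hD : IsClosed D) (hCD : Disjoint C D) (hU : IsOpen U) (hV : IsOpen V) (hCU : C ⊆ U)
    (hDV : D ⊆ V) : ∃ t : C(Z, ℝ), EqOn t 0 C ∧ EqOn t 1 D ∧ (∀ x, t x ∈ Icc (0 : ℝ) 1) ∧
      (∀ x, t x < 1 / 2 → x ∈ U) ∧ ∀ x, 1 / 2 < t x → x ∈ V := by
  obtain ⟨g, hgC, hg1, hg⟩ := exists_continuous_zero_one_of_isClosed hC (hU.isClosed_compl.union hD)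
    (disjoint_union_right.2 ⟨disjoint_compl_right_iff_subset.2 hCU, hCD⟩)
  obtain ⟨h, hhD, hh1, hh⟩ := exists_continuous_zero_one_of_isClosed hD (hV.isClosed_compl.union hC)
    (disjoint_union_right.2 ⟨disjoint_compl_right_iff_subset.2 hDV, hCD.symm⟩)
  refine ⟨⟨fun x => (1 + g x - h x) / 2, by fun_prop⟩, fun x hx => ?_, fun x hx => ?_,
    fun x => ?_, fun x hx => ?_, fun x hx => ?_⟩
  · simp [hgC hx, hh1 (.inr hx)]
  · simp [hg1 (.inr hx), hhD hx]
  · have := hg x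
    have := hh x
    simp only [ContinuousMap.coe_mk, mem_Icc] at *
    constructor <;> linarith
  · by_contra hxU
    have hgx : g x = 1 := hg1 (.inl hxU)
    have := (hh x).2
    simp only [ContinuousMap.coe_mk] at hx
    linarith
  · by_contra hxV
    have hhx : h x = 1 := hh1 (.inl hxV)
    have := (hg x).2
    simp only [ContinuousMap.coe_mk] at hx
    linarith

/-- If `f` separates `A` from `B` and `t` separates `C` from `D`, then the partition is the
preimage under `(f, t)` of the graph of the zigzag in the square. -/
theorem exists_isPartition_isCrookedOn [NormalSpace Z] {A B C D U V : Set Z} (hA : IsClosed A)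
    (hB : IsClosed B) (hAB : Disjoint A B) (hC : IsClosed C) (hD : IsClosed D)
    (hCD : Disjoint C D) (hU : IsOpen U) (hV : IsOpen V) (hCU : C ⊆ U) (hDV : D ⊆ V) :
    ∃ L, IsPartition L A B ∧ IsCrookedOn L C D U V := by
  obtain ⟨f, hfA, hfB, -⟩ := exists_continuous_zero_one_of_isClosed hA hB hAB
  obtain ⟨t, htC, htD, ht, htU, htV⟩ := exists_continuous_zero_one_half hC hD hCD hU hV hCU hDV
  have hzf : Continuous fun x => zigzag (f x) := continuous_zigzag.comp f.continuous
  have hL : IsClosed {x | zigzag (f x) = t x} := isClosed_eq hzf t.continuous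
  refine ⟨{x | zigzag (f x) = t x}, isPartition_setOf_eq hzf t.continuous (fun x hx => ?_)
    fun x hx => ?_, {x | zigzag (f x) = t x ∧ f x ≤ 1 / 3},
    {x | zigzag (f x) = t x ∧ f x ∈ Icc (1 / 3) (2 / 3)}, {x | zigzag (f x) = t x ∧ 2 / 3 ≤ f x},
    hL.inter (isClosed_Iic.preimage f.continuous), hL.inter (isClosed_Icc.preimage f.continuous),
    hL.inter (isClosed_Ici.preimage f.continuous), ?_, ?_, ?_, ?_, ?_, ?_⟩
  · rw [hfA hx, Pi.zero_apply, zigzag_zero]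
    linarith [(ht x).1]
  · rw [hfB hx, Pi.one_apply, zigzag_one]
    linarith [(ht x).2]
  · intro x hx
    rcases le_total (f x) (1 / 3) with h | h
    · exact .inl (.inl ⟨hx, h⟩)
    · exact (le_total (f x) (2 / 3)).imp (fun h' => .inr ⟨hx, h, h'⟩) (fun h' => ⟨hx, h'⟩)
  · rintro x ⟨hxC, hx⟩
    exact ⟨hx, le_of_not_gt fun h => (zigzag_pos h).ne' (hx.trans (htC hxC))⟩
  · rintro x ⟨hxD, hx⟩
    exact ⟨hx, le_of_not_gt fun h => (zigzag_lt_one h).ne (hx.trans (htD hxD))⟩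
  · rintro x ⟨⟨hx, h⟩, -, h', -⟩
    refine htV x ?_
    rw [← hx, h.antisymm h', zigzag_one_third]
    norm_num
  · rintro x ⟨⟨hx, -, h⟩, -, h'⟩
    refine htU x ?_
    rw [← hx, h.antisymm h', zigzag_two_thirds]
    norm_num
  · refine disjoint_left.2 fun x h h' => ?_
    linarith [h.2, h'.2]

end Crooked

section HereditarilyIndecomposable

open TopologicalSpace

variable {Z : Type*} [TopologicalSpace Z]

lemma hereditarilyIndecomposable_of_nested {K : Set Z} (hK : IsClosed K)
    (h : ∀ E ⊆ K, ∀ F ⊆ K, IsSubcontinuum E → IsSubcontinuum F → (E ∩ F).Nonempty →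
      E ⊆ F ∨ F ⊆ E) : HereditarilyIndecomposable K := by
  rintro M ⟨-, hM⟩ ⟨E, F, hE, hF, hEM, hFM, hEF⟩
  have himage {S : Set K} (hS : IsSubcontinuum S) : IsSubcontinuum (Subtype.val '' S) :=
    ⟨hK.isClosedMap_subtype_val S hS.1, hS.2.image _ continuous_subtype_val.continuousOn⟩
  have hmeet : (E ∩ F).Nonempty := by
    refine (isPreconnected_closed_iff.1 hM.isPreconnected E F hE.1 hF.1 hEF.ge ?_ ?_).mono
      inter_subset_right
    · rw [inter_eq_right.2 hEM.subset]
      exact hE.2.nonempty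
    · rw [inter_eq_right.2 hFM.subset]
      exact hF.2.nonempty
  rcases h _ (Subtype.coe_image_subset K E) _ (Subtype.coe_image_subset K F) (himage hE)
    (himage hF) ((hmeet.image _).mono (image_inter_subset _ _ _)) with hsub | hsub <;>
    rw [image_subset_image_iff Subtype.val_injective] at hsub
  · exact hFM.ne (by rwa [union_eq_right.2 hsub] at hEF)
  · exact hEM.ne (by rwa [union_eq_left.2 hsub] at hEF)

/-- The quadruples `(c, U, d, V)` of members of `𝓑` for which folding between the disjoint sets
`closure c ⊆ U` and `closure d ⊆ V` is required. -/
def foldingQuadruples (𝓑 : Set (Set Z)) : Set (Set Z × Set Z × Set Z × Set Z) :=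
  {q ∈ 𝓑 ×ˢ 𝓑 ×ˢ 𝓑 ×ˢ 𝓑 | closure q.1 ⊆ q.2.1 ∧ closure q.2.2.1 ⊆ q.2.2.2 ∧
    Disjoint (closure q.1) (closure q.2.2.1)}

lemma exists_mem_basis_closure_subset [RegularSpace Z] {𝓑 : Set (Set Z)}
    (h𝓑 : IsTopologicalBasis 𝓑) {x : Z} {O : Set Z} (hO : IsOpen O) (hx : x ∈ O) :
    ∃ c ∈ 𝓑, ∃ U ∈ 𝓑, x ∈ c ∧ closure c ⊆ U ∧ U ⊆ O := by
  obtain ⟨U, hU, hxU, hUO⟩ := h𝓑.exists_subset_of_mem_open hx hO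
  obtain ⟨c, hc, hxc, hcU⟩ := h𝓑.exists_closure_subset ((h𝓑.isOpen hU).mem_nhds hxU)
  exact ⟨c, hc, U, hU, hxc, hcU, hUO⟩

theorem hereditarilyIndecomposable_of_isCrookedOn [T3Space Z] {𝓑 : Set (Set Z)}
    (h𝓑 : IsTopologicalBasis 𝓑) {K : Set Z} (hK : IsClosed K)
    (hcrooked : ∀ q ∈ foldingQuadruples 𝓑,
      IsCrookedOn K (closure q.1) (closure q.2.2.1) q.2.1 q.2.2.2) :
    HereditarilyIndecomposable K := by
  refine hereditarilyIndecomposable_of_nested hK fun E hEK F hFK hE hF hmeet => ?_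
  by_contra! hnot
  obtain ⟨⟨a, haE, haF⟩, b, hbF, hbE⟩ := hnot.imp not_subset.1 not_subset.1
  obtain ⟨P, Q, hP, hQ, haP, hbQ, hPQ⟩ := t2_separation (ne_of_mem_of_not_mem haE hbE)
  obtain ⟨c, hc, U, hU, hac, hcU, hUP⟩ := exists_mem_basis_closure_subset h𝓑
    (hP.inter hF.1.isOpen_compl) ⟨haP, haF⟩
  obtain ⟨d, hd, V, hV, hbd, hdV, hVQ⟩ := exists_mem_basis_closure_subset h𝓑
    (hQ.inter hE.1.isOpen_compl) ⟨hbQ, hbE⟩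
  obtain ⟨hUP, hUF⟩ := subset_inter_iff.1 hUP
  obtain ⟨hVQ, hVE⟩ := subset_inter_iff.1 hVQ
  refine not_disjoint_iff_nonempty_inter.2 hmeet ((hcrooked (c, U, d, V) ⟨⟨hc, hU, hd, hV⟩, hcU,
    hdV, hPQ.mono (hcU.trans hUP) (hdV.trans hVQ)⟩).disjoint hE.2.isPreconnected
    hF.2.isPreconnected hEK hFK ⟨a, haE, subset_closure hac⟩ ⟨b, hbF, subset_closure hbd⟩ ?_ ?_)
  · exact subset_compl_iff_disjoint_left.1 hVE
  · exact subset_compl_iff_disjoint_left.1 hUF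

end HereditarilyIndecomposable

section Weight

open Cardinal TopologicalSpace

variable {X Y : Type u} [TopologicalSpace X] [TopologicalSpace Y]

lemma weight_le_mk {𝓑 : Set (Set X)} (h𝓑 : IsTopologicalBasis 𝓑) : weight X ≤ #𝓑 :=
  csInf_le' ⟨𝓑, h𝓑, rfl⟩

variable (X) in
lemma exists_isTopologicalBasis_mk_eq_weight :
    ∃ 𝓑 : Set (Set X), IsTopologicalBasis 𝓑 ∧ #𝓑 = weight X :=
  csInf_mem (s := {c | ∃ 𝓑 : Set (Set X), IsTopologicalBasis 𝓑 ∧ #𝓑 = c})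
    ⟨_, _, isTopologicalBasis_opens, rfl⟩

lemma weight_le_of_isInducing {f : X → Y} (hf : IsInducing f) : weight X ≤ weight Y := by
  obtain ⟨𝓑, h𝓑, hcard⟩ := exists_isTopologicalBasis_mk_eq_weight Y
  exact (weight_le_mk (h𝓑.isInducing hf)).trans (mk_image_le.trans_eq hcard)

lemma mk_setOf_finite_subset_le {α : Type u} (s : Set α) :
    #{t : Set α | t.Finite ∧ t ⊆ s} ≤ max #s ℵ₀ := by
  have hrange : {t : Set α | t.Finite ∧ t ⊆ s} ⊆ range fun F : Finset s => (↑) '' (F : Set s) := by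
    rintro t ⟨ht, hts⟩
    refine ⟨(ht.preimage Subtype.val_injective.injOn).toFinset, ?_⟩
    beta_reduce
    rw [Finite.coe_toFinset, Subtype.image_preimage_coe, inter_eq_right.2 hts]
  refine (mk_le_mk_of_subset hrange).trans (mk_range_le.trans ?_)
  cases finite_or_infinite s
  · exact le_max_of_le_right mk_le_aleph0
  · exact le_max_of_le_left (mk_finset_of_infinite s).le

lemma weight_le_of_eq_generateFrom {𝓢 : Set (Set X)}
    (h𝓢 : ‹TopologicalSpace X› = generateFrom 𝓢) : weight X ≤ max #𝓢 ℵ₀ :=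
  (weight_le_mk (isTopologicalBasis_of_subbasis h𝓢)).trans
    (mk_image_le.trans (mk_setOf_finite_subset_le 𝓢))

theorem weight_pi_le {J : Type u} [Infinite J] {X : J → Type v} [∀ j, TopologicalSpace (X j)]
    [∀ j, SecondCountableTopology (X j)] : weight (∀ j, X j) ≤ lift.{v} #J := by
  let 𝓢 (j : J) : Set (Set (∀ j, X j)) := preimage (Function.eval j) '' countableBasis (X j)
  have hJ : ℵ₀ ≤ lift.{v} #J := aleph0_le_lift.2 (aleph0_le_mk J)
  have h𝓢 : (Pi.topologicalSpace : TopologicalSpace (∀ j, X j)) = generateFrom (⋃ j, 𝓢 j) := by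
    rw [generateFrom_iUnion]
    refine iInf_congr fun j => ?_
    rw [← induced_generateFrom_eq, ← (isBasis_countableBasis (X j)).eq_generateFrom]
  have hcard : #(⋃ j, 𝓢 j) ≤ lift.{v} #J := by
    have hcountable (j : J) : #(𝓢 j) ≤ ℵ₀ := ((countable_countableBasis _).image _).le_aleph0
    refine lift_le.{u}.1 (mk_iUnion_le_sum_mk_lift.trans ((sum_le_sum _ _ hcountable).trans ?_))
    simp
  exact (weight_le_of_eq_generateFrom h𝓢).trans (max_le hcard hJ)

lemma exists_finset_basis_subset_iUnion {𝓑 : Set (Set X)} (h𝓑 : IsTopologicalBasis 𝓑)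
    {K O : Set X} (hK : IsCompact K) (hO : IsOpen O) (hKO : K ⊆ O) :
    ∃ t : Finset 𝓑, K ⊆ ⋃ W ∈ t, W.1 ∧ ⋃ W ∈ t, W.1 ⊆ O := by
  classical
  obtain ⟨ι, W, rfl, hW⟩ := h𝓑.open_eq_iUnion hO
  obtain ⟨t, ht⟩ := hK.elim_finite_subcover W (fun i => h𝓑.isOpen (hW i)) hKO
  refine ⟨t.image fun i => ⟨W i, hW i⟩, ?_⟩
  rw [Finset.set_biUnion_finset_image]
  exact ⟨ht, iUnion₂_subset fun i _ => subset_iUnion W i⟩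

theorem mk_le_weight_of_nonempty_inter [CompactSpace X] {J : Type u} [Infinite J]
    {A B : J → Set X} (hA : ∀ j, IsClosed (A j)) (hB : ∀ j, IsClosed (B j))
    (hAB : ∀ j, Disjoint (A j) (B j)) (hinter : ∀ i j, i ≠ j → (A i ∩ B j).Nonempty) :
    #J ≤ weight X := by
  obtain ⟨𝓑, h𝓑, hcard⟩ := exists_isTopologicalBasis_mk_eq_weight X
  choose t hAt htB using fun j => exists_finset_basis_subset_iUnion h𝓑 (hA j).isCompact
    (hB j).isOpen_compl (hAB j).subset_compl_right
  have ht : Function.Injective t := by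
    intro i j hij
    by_contra hne
    obtain ⟨x, hxA, hxB⟩ := hinter i j hne
    exact htB j (hij ▸ hAt i hxA) hxB
  have : Infinite 𝓑 := not_finite_iff_infinite.1 fun _ =>
    not_finite_iff_infinite.2 (Infinite.of_injective t ht) inferInstance
  calc #J ≤ #(Finset 𝓑) := mk_le_of_injective ht
    _ = weight X := (mk_finset_of_infinite 𝓑).trans hcard

theorem mk_le_weight_of_surjective [CompactSpace X] {J : Type u} [Infinite J]
    {f : X → J → unitInterval} (hf : Continuous f) (hsurj : Function.Surjective f) :
    #J ≤ weight X := by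
  classical
  refine mk_le_weight_of_nonempty_inter (A := fun j => f ⁻¹' faceZero j)
    (B := fun j => f ⁻¹' faceOne j)
    (fun j => (isClosed_faceZero j).preimage hf) (fun j => (isClosed_faceOne j).preimage hf)
    (fun j => (disjoint_faceZero_faceOne j).preimage f) fun i j hij => ?_
  obtain ⟨x, hx⟩ := hsurj (Function.update 1 i 0)
  exact ⟨x, by simp [faceZero, hx], by simp [faceOne, hx, hij.symm]⟩

end Weight

section Existence

open Cardinal TopologicalSpace

lemma mk_foldingQuadruples_le {Z : Type u} [TopologicalSpace Z] {𝓑 : Set (Set Z)} {κ : Cardinal.{u}}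
    (hκ : ℵ₀ ≤ κ) (h𝓑 : #𝓑 ≤ κ) : #(foldingQuadruples 𝓑) ≤ κ := by
  refine (mk_le_mk_of_subset (sep_subset _ _)).trans ?_
  simp only [mk_setProd]
  calc #𝓑 * (#𝓑 * (#𝓑 * #𝓑)) ≤ κ * (κ * (κ * κ)) := by gcongr
    _ = κ := by simp only [mul_eq_self hκ]

theorem exists_hereditarilyIndecomposable_isEssentialOn {Z J : Type u} {ι : Type*}
    [TopologicalSpace Z] [CompactSpace Z] [T2Space Z] [Infinite J] (hZ : weight Z ≤ #J)
    {A B : ι ⊕ J → Set Z} (h : IsEssentialFamily A B) : ∃ K : Set Z, IsClosed K ∧ IsConnected K ∧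
      HereditarilyIndecomposable K ∧ IsEssentialOn (A ∘ .inl) (B ∘ .inl) K := by
  obtain ⟨𝓑, h𝓑, hcard⟩ := exists_isTopologicalBasis_mk_eq_weight Z
  obtain ⟨e⟩ : #(foldingQuadruples 𝓑) ≤ #J :=
    mk_foldingQuadruples_le (aleph0_le_mk J) (hcard.trans_le hZ)
  have he := h.comp_injective (Sum.map_injective.2 ⟨Function.injective_id, e.injective⟩)
  choose L hL hcrooked using fun q : foldingQuadruples 𝓑 => exists_isPartition_isCrookedOn
    (he.1 (.inr q)).1 (he.1 (.inr q)).2.1 (he.1 (.inr q)).2.2 isClosed_closure isClosed_closure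
    q.2.2.2.2 (h𝓑.isOpen q.2.1.2.1) (h𝓑.isOpen q.2.1.2.2.2) q.2.2.1 q.2.2.2.1
  obtain ⟨K, hKL, hK, hconn, hess⟩ := (he.isEssentialOn_iInter hL).exists_isConnected
    (isClosed_iInter fun q => (hL q).isClosed) (fun i => (h.1 (.inl i)).1)
    (fun i => (h.1 (.inl i)).2.1) fun i => (h.1 (.inl i)).2.2
  exact ⟨K, hK, hconn, hereditarilyIndecomposable_of_isCrookedOn h𝓑 hK fun q hq =>
    (hcrooked ⟨q, hq⟩).mono (hKL.trans (iInter_subset L ⟨q, hq⟩)), hess⟩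

end Existence

end HIContinua

theorem mainTheorem2 (κ : Cardinal.{u}) (hκ : Cardinal.aleph0 ≤ κ) :
    ∃ (X : Type u) (_ : TopologicalSpace X),
      HIContinua.IsContinuum X ∧ HIContinua.HereditarilyIndecomposable X ∧
      HIContinua.weight X = κ ∧
      ∃ f : X → (κ.out → unitInterval),
        HIContinua.IsEssentialMap f ∧ Function.Surjective f := by
  have : Infinite κ.out := by rwa [Cardinal.infinite_iff, Cardinal.mk_out]
  have hcube : HIContinua.weight (κ.out ⊕ κ.out → unitInterval) ≤ κ :=
    HIContinua.weight_pi_le.trans_eq (by simp [Cardinal.add_eq_self hκ])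
  obtain ⟨K, hK, hconn, hindec, hess⟩ :=
    HIContinua.exists_hereditarilyIndecomposable_isEssentialOn (hcube.trans_eq κ.mk_out.symm)
      HIContinua.isEssentialFamily_faceZero_faceOne
  have : CompactSpace K := isCompact_iff_compactSpace.1 hK.isCompact
  let f (x : K) (i : κ.out) : unitInterval := x.1 (Sum.inl i)
  have hf : HIContinua.IsEssentialMap f :=
    ⟨continuous_pi fun i => (continuous_apply (Sum.inl i)).comp continuous_subtype_val,
      hess.isEssentialFamily_preimage_val hK (fun _ => HIContinua.isClosed_faceZero _)
        (fun _ => HIContinua.isClosed_faceOne _) fun _ => HIContinua.disjoint_faceZero_faceOne _⟩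
  refine ⟨K, inferInstance, ⟨inferInstance, inferInstance, isConnected_iff_connectedSpace.1 hconn⟩,
    hindec, le_antisymm ?_ ?_, f, hf, hf.surjective⟩
  · exact (HIContinua.weight_le_of_isInducing Topology.IsInducing.subtypeVal).trans hcube
  · exact κ.mk_out.ge.trans (HIContinua.mk_le_weight_of_surjective hf.1 hf.surjective)
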